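/- Let $\mathsf{k}$ be an infinite field, $R=\mathsf{k}[s,t]$, and let $R_n\subseteq R$ be the space of homogeneous polynomials of degree $n$. Let $d\ge 2$, let $1\le \mu_1\le\dots\le\mu_d$ be integers, $\mu=(\mu_1,\dots,\mu_d)$, and $n=\mu_1+\dots+\mu_d$. Let $\mathcal{P}^{\mu}_{n,d}$ be the set of all $(a_0,\dots,a_d)\in R_n^{d+1}$ such that $a_0,\dots,a_d$ are linearly independent over $\mathsf{k}$ and relatively prime in $R$, and that have $\mu$-type $\mu$, i.e. for which there is an exact sequence of graded $R$-modules \[0\longrightarrow \bigoplus_{i=1}^d R(-n-\mu_i)\longrightarrow R(-n)^{d+1}\xrightarrow{(a_0,\dots,a_d)}\langle a_0,\dots,a_d\rangle\longrightarrow 0 .\] Call $(a_0,\dots,a_d)$ proper if the map $\mathbb{P}^1\to\mathbb{P}^d$ that it defines is birational onto its image (the Zariski closure $C$ of the image, with inverse rational map $C\dashrightarrow\mathbb{P}^1$ defined over $\mathsf{k}$). Then every element of $\mathcal{P}^{\mu}_{n,d}$ is proper if and only if $\gcd(\mu_1,\dots,\mu_d)=1$. -/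

import Mathlib

open MvPolynomial

namespace RationalCurve

/-- `𝒫_{n,d}`: the tuples `(a₀, …, a_d)` of homogeneous forms of degree `n` in two variables
(`X 0 = s`, `X 1 = t`) that are linearly independent over `K` and relatively prime, that is,
have no common divisor except units. -/
def paramSpace (K : Type*) [Field K] (n d : ℕ) : Set (Fin (d + 1) → MvPolynomial (Fin 2) K) :=
  {a | (∀ j, (a j).IsHomogeneous n) ∧ LinearIndependent K a ∧
    ∀ h : MvPolynomial (Fin 2) K, (∀ j, h ∣ a j) → IsUnit h}

/-- `a = (a₀, …, a_d)`, forms of one degree `n`, has `μ`-type `μ = (μ₁ ≤ … ≤ μ_d)`, all `μᵢ ≥ 1`: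
there is an exact sequence of graded modules over `R = K[s,t]`
`0 ⟶ ⨁ᵢ R(-n-μᵢ) ⟶ R(-n)^{d+1} ⟶ ⟨a₀, …, a_d⟩ ⟶ 0`, with maps `A` and `B = (a₀, …, a_d)`.
The row `A i` below is the `i`-th column of the matrix of `A`; preserving degrees means that
its entries are homogeneous of degree `μᵢ`. Surjectivity of `B` onto the ideal generated by its
entries is automatic, so it is not listed. -/
def HasMuType {K : Type*} [Field K] {d : ℕ} (a : Fin (d + 1) → MvPolynomial (Fin 2) K)
    (μ : Fin d → ℕ) : Prop :=
  Monotone μ ∧ (∀ i, 1 ≤ μ i) ∧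
    ∃ A : Fin d → Fin (d + 1) → MvPolynomial (Fin 2) K,
      (∀ i j, (A i j).IsHomogeneous (μ i)) ∧
      Function.Injective (Fintype.linearCombination (MvPolynomial (Fin 2) K) A) ∧
      Function.Exact (Fintype.linearCombination (MvPolynomial (Fin 2) K) A)
        (Fintype.linearCombination (MvPolynomial (Fin 2) K) a)

/-- The `μ`-stratum `𝒫^μ_{n,d}`. -/
def muStratum (K : Type*) [Field K] (n d : ℕ) (μ : Fin d → ℕ) :
    Set (Fin (d + 1) → MvPolynomial (Fin 2) K) :=
  {a | a ∈ paramSpace K n d ∧ HasMuType a μ}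

/-- The ideal of the image curve `C ⊆ ℙ^d` of `a : ℙ¹ → ℙ^d`: all relations
`P(a₀, …, a_d) = 0` with `P ∈ K[x₀, …, x_d]`. -/
noncomputable def curveIdeal {K : Type*} [Field K] {d : ℕ}
    (a : Fin (d + 1) → MvPolynomial (Fin 2) K) : Ideal (MvPolynomial (Fin (d + 1)) K) :=
  RingHom.ker (aeval a : MvPolynomial (Fin (d + 1)) K →ₐ[K] MvPolynomial (Fin 2) K)

/-- The parametrization `a : ℙ¹ → ℙ^d` is proper, that is, birational onto its image curve `C`:
there is a rational map `C ⇢ ℙ¹`, given by two forms `G 0, G 1 ∈ K[x₀, …, x_d]` of one degree that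
do not both vanish on `C`, which is inverse to `a : ℙ¹ ⇢ C` as a rational map. -/
def IsProper {K : Type*} [Field K] {d : ℕ} (a : Fin (d + 1) → MvPolynomial (Fin 2) K) : Prop :=
  ∃ (e : ℕ) (G : Fin 2 → MvPolynomial (Fin (d + 1)) K),
    (∀ l, (G l).IsHomogeneous e) ∧
    -- `G` is defined at the generic point of `C`
    (∃ l, G l ∉ curveIdeal a) ∧
    -- `G ∘ a = id` on `ℙ¹`: `[G₀(a) : G₁(a)] = [s : t]`
    X 0 * aeval a (G 1) = X 1 * aeval a (G 0) ∧
    -- `a ∘ G` is defined at the generic point of `C`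
    (∃ j, aeval G (a j) ∉ curveIdeal a) ∧
    -- `a ∘ G = id` on `C`: `[a₀(G) : … : a_d(G)] = [x₀ : … : x_d]` modulo the ideal of `C`
    ∀ i j, X i * aeval G (a j) - X j * aeval G (a i) ∈ curveIdeal a

end RationalCurve

/-! Suppose the gcd is 1. By Lüroth the ratios `a j / a 0` generate a field `K(f)`, and `f = p / q`
with coprime forms `p, q` of one degree `k`, where `k = [K(s/t) : K(f)]`. Clearing denominators
makes `a` proportional to a tuple `b j (p, q)`, so the two have the same syzygies over `K[s,t]`. As
`p, q` is a regular sequence, `K[s,t]` is free over `K[p, q]` on a set of monomials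
(`exists_basis_over_aeval`); hence every syzygy is a combination of syzygies with entries in `K[p,
q]`, and these entries live in degrees divisible by `k`. So `k` divides every `μ i`
(`dvd_degree_of_syzygies_eq`), whence `k = 1`. Then `s/t` is a quotient of two forms in `a`, and
these forms give the inverse map.

Conversely, if `g = gcd μ ≥ 2`, the curve of monomials whose `t`-exponents are the partial sums of
`μ` has type `μ`, but its entries lie in `K[s^g, t^g]`. Nothing built from them can recover `[s :
t]` (`not_isProper_monomialCurve`). -/

namespace RationalCurve

/-! ### Linear independence over `K[p, q]` for a regular sequence. -/

section RegularPair

variable {K : Type*} [Field K]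

theorem exists_eq_X_mul_add_C (c : MvPolynomial (Fin 2) K) :
    ∃ α β : MvPolynomial (Fin 2) K, c = C (coeff 0 c) + X 0 * α + X 1 * β := by
  induction c using MvPolynomial.induction_on with
  | C r => exact ⟨0, 0, by simp⟩
  | add f g hf hg =>
    obtain ⟨α, β, h⟩ := hf
    obtain ⟨α', β', h'⟩ := hg
    refine ⟨α + α', β + β', ?_⟩
    rw [coeff_add, C_add]
    linear_combination h + h'
  | mul_X f i _ =>
    fin_cases i
    · exact ⟨f, 0, by simp [mul_comm f, coeff_X_mul']⟩
    · exact ⟨0, f, by simp [mul_comm f, coeff_X_mul']⟩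

/-- A monomial of `c` free of `X 0` is a power of `X 1`, and it cannot occur in `X 1 ^ N * β` once
`N` exceeds its exponent. -/
theorem X_zero_dvd_of_forall (c : MvPolynomial (Fin 2) K)
    (h : ∀ N, ∃ α β : MvPolynomial (Fin 2) K, c = X 0 * α + X 1 ^ N * β) : X 0 ∣ c := by
  rw [X_dvd_iff_modMonomial_eq_zero]
  ext m
  by_cases hm : Finsupp.single 0 1 ≤ m
  · rw [coeff_modMonomial_of_le _ hm, coeff_zero]
  · rw [coeff_modMonomial_of_not_le _ hm, coeff_zero]
    obtain ⟨α, β, rfl⟩ := h (m 1 + 1)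
    have h0 : m 0 = 0 := by
      by_contra h0
      exact hm (Finsupp.single_le_iff.2 (by omega))
    rw [coeff_add, coeff_X_mul', X_pow_eq_monomial, coeff_monomial_mul']
    rw [if_neg (by simp [h0]), if_neg, add_zero]
    intro hle
    have := hle 1
    simp at this

variable {B ι : Type*} [CommRing B] [Algebra K B]

/-- A family that is linearly independent modulo a regular sequence `p, q` over the base field is
linearly independent over `K[p, q]`. -/
theorem eq_zero_of_sum_aeval_mul_eq_zero {p q : B} (hp : ∀ x, p * x = 0 → x = 0)
    (hq : ∀ x, p ∣ q * x → p ∣ x) (e : ι → B) (F : Finset ι)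
    (he : ∀ κ : ι → K, ∑ i ∈ F, κ i • e i ∈ Ideal.span {p, q} → ∀ i ∈ F, κ i = 0)
    (c : ι → MvPolynomial (Fin 2) K) (hc : ∑ i ∈ F, aeval ![p, q] (c i) * e i = 0) :
    ∀ i ∈ F, c i = 0 := by
  -- Work modulo `p`: the power `q ^ N` cancels from the remaining relation among the `β i`, whose
  -- constant terms then form a relation modulo `(p, q)` and vanish by `he`. So one more factor `X
  -- 1` splits off.
  have step (c : ι → MvPolynomial (Fin 2) K) (hc : p ∣ ∑ i ∈ F, aeval ![p, q] (c i) * e i) :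
      ∀ N, ∃ α β : ι → MvPolynomial (Fin 2) K, ∀ i ∈ F, c i = X 0 * α i + X 1 ^ N * β i := by
    intro N
    induction N with
    | zero => exact ⟨0, c, by simp⟩
    | succ N ih =>
      obtain ⟨α, β, h⟩ := ih
      have h1 : p ∣ q ^ N * ∑ i ∈ F, aeval ![p, q] (β i) * e i := by
        have : ∑ i ∈ F, aeval ![p, q] (c i) * e i =
            p * ∑ i ∈ F, aeval ![p, q] (α i) * e i +
              q ^ N * ∑ i ∈ F, aeval ![p, q] (β i) * e i := by
          rw [Finset.mul_sum, Finset.mul_sum, ← Finset.sum_add_distrib]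
          refine Finset.sum_congr rfl fun i hi ↦ ?_
          rw [h i hi]
          simp
          ring
        rw [this] at hc
        exact (dvd_add_right (dvd_mul_right _ _)).1 hc
      have h2 (M : ℕ) (y : B) (hy : p ∣ q ^ M * y) : p ∣ y := by
        induction M with
        | zero => simpa using hy
        | succ M ihM => exact ihM (hq _ (by rwa [← mul_assoc, ← pow_succ']))
      have h3 := h2 _ _ h1
      choose γ δ hγδ using fun i ↦ exists_eq_X_mul_add_C (β i)
      have h4 : ∑ i ∈ F, coeff 0 (β i) • e i ∈ Ideal.span {p, q} := by
        have : ∑ i ∈ F, coeff 0 (β i) • e i = ∑ i ∈ F, aeval ![p, q] (β i) * e i -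
            (p * ∑ i ∈ F, aeval ![p, q] (γ i) * e i +
              q * ∑ i ∈ F, aeval ![p, q] (δ i) * e i) := by
          rw [Finset.mul_sum, Finset.mul_sum, ← Finset.sum_add_distrib, ← Finset.sum_sub_distrib]
          refine Finset.sum_congr rfl fun i _ ↦ ?_
          conv_rhs => rw [hγδ i]
          simp [Algebra.smul_def]
          ring
        rw [this]
        refine sub_mem (Ideal.mem_of_dvd _ h3 (Ideal.subset_span (by simp)))
          (add_mem (Ideal.mul_mem_right _ _ (Ideal.subset_span (by simp)))
            (Ideal.mul_mem_right _ _ (Ideal.subset_span (by simp))))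
      have h5 := he _ h4
      refine ⟨fun i ↦ α i + X 1 ^ N * γ i, δ, fun i hi ↦ ?_⟩
      have := hγδ i
      rw [h5 i hi, C_0, zero_add] at this
      rw [h i hi]
      linear_combination X 1 ^ N * this
  -- By `step`, every coefficient is divisible by `X 0`. Since `p` is not a zero divisor, the
  -- quotients satisfy the same relation, and the descent repeats.
  have step2 : ∀ N, ∀ c : ι → MvPolynomial (Fin 2) K, ∑ i ∈ F, aeval ![p, q] (c i) * e i = 0 →
      ∀ i ∈ F, X 0 ^ N ∣ c i := by
    intro N
    induction N with
    | zero => simp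
    | succ N ih =>
      intro c hc i hi
      have h1 : ∀ i, ∃ d, i ∈ F → c i = X 0 * d := by
        intro i
        by_cases hi : i ∈ F
        · obtain ⟨d, hd⟩ := X_zero_dvd_of_forall (c i) fun N ↦ by
            obtain ⟨α, β, h⟩ := step c (hc ▸ dvd_zero _) N
            exact ⟨_, _, h i hi⟩
          exact ⟨d, fun _ ↦ hd⟩
        · exact ⟨0, fun h ↦ absurd h hi⟩
      choose d hd using h1
      have h2 : ∑ i ∈ F, aeval ![p, q] (d i) * e i = 0 := by
        apply hp
        rw [← hc, Finset.mul_sum]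
        refine Finset.sum_congr rfl fun i hi ↦ ?_
        rw [hd i hi]
        simp
        ring
      rw [hd i hi, pow_succ']
      exact mul_dvd_mul_left _ (ih d h2 i hi)
  intro i hi
  by_contra h
  have h1 := step2 ((c i).totalDegree + 1) c hc i hi
  have h2 := totalDegree_le_of_dvd_of_isDomain h1 h
  rw [totalDegree_X_pow] at h2
  omega

end RegularPair

/-! ### Generation over `K[p, q]` by monomials. -/

section Graded

variable {K : Type*} [Field K] {σ : Type*}

theorem homogeneousComponent_mul_of_isHomogeneous {g A : MvPolynomial σ K} {m : ℕ}
    (hA : A.IsHomogeneous m) (N : ℕ) :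
    homogeneousComponent N (g * A) =
      if m ≤ N then homogeneousComponent (N - m) g * A else 0 := by
  let := gradedAlgebra (σ := σ) (R := K)
  have key (f : MvPolynomial σ K) (M : ℕ) :
      (DirectSum.decompose (homogeneousSubmodule σ K) f M : MvPolynomial σ K) =
        homogeneousComponent M f := decomposition.decompose'_apply f M
  rw [← key, ← key]
  exact DirectSum.coe_decompose_mul_of_right_mem (homogeneousSubmodule σ K) N hA

/-- Every polynomial is a combination, with coefficients in `K[p, q]`, of monomials spanning
`K[σ]` modulo `(p, q)`. -/
theorem exists_sum_aeval_mul_eq {p q : MvPolynomial σ K} {k : ℕ} (hk : 0 < k)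
    (hp : p.IsHomogeneous k) (hq : q.IsHomogeneous k) (B : Set (σ →₀ ℕ))
    (hB : ∀ r : MvPolynomial σ K, ∃ κ : (σ →₀ ℕ) →₀ K, ↑κ.support ⊆ B ∧
      ∃ α β, r = κ.sum (fun m c ↦ monomial m c) + α * p + β * q) (r : MvPolynomial σ K) :
    ∃ c : (σ →₀ ℕ) →₀ MvPolynomial (Fin 2) K, ↑c.support ⊆ B ∧
      r = c.sum fun m s ↦ aeval ![p, q] s * monomial m 1 := by
  classical
  let Φ : ((σ →₀ ℕ) →₀ MvPolynomial (Fin 2) K) →+ MvPolynomial σ K :=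
    Finsupp.liftAddHom fun m ↦
      (AddMonoidHom.mulRight (monomial m 1)).comp (aeval ![p, q]).toRingHom.toAddMonoidHom
  have hΦ c : Φ c = c.sum fun m s ↦ aeval ![p, q] s * monomial m 1 := rfl
  simp_rw [← hΦ]
  let T : AddSubgroup (MvPolynomial σ K) :=
    (Finsupp.supported _ (MvPolynomial (Fin 2) K) B).toAddSubgroup.map Φ
  have hT x : x ∈ T ↔ ∃ c : (σ →₀ ℕ) →₀ MvPolynomial (Fin 2) K, ↑c.support ⊆ B ∧ x = Φ c := by
    simp [T, Finsupp.mem_supported, eq_comm]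
  have hmul (s : MvPolynomial (Fin 2) K) (x) (hx : x ∈ T) : x * aeval ![p, q] s ∈ T := by
    obtain ⟨c, hc, rfl⟩ := (hT _).1 hx
    refine (hT _).2 ⟨s • c, fun m hm ↦ hc (Finsupp.support_smul hm), ?_⟩
    rw [hΦ, hΦ, Finsupp.sum_smul_index (by simp), Finsupp.sum, Finsupp.sum, Finset.sum_mul]
    refine Finset.sum_congr rfl fun m _ ↦ ?_
    rw [map_mul]; ring
  have hmono (m) (hm : m ∈ B) (x : K) : monomial m x ∈ T := by
    refine (hT _).2 ⟨Finsupp.single m (C x), ?_, ?_⟩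
    · intro y hy
      have := Finsupp.support_single_subset hy
      simp only [Finset.mem_singleton] at this
      exact this ▸ hm
    · rw [hΦ, Finsupp.sum_single_index (by simp)]
      simp [algebraMap_eq, C_mul_monomial]
  -- In the degree `N` part of `α * p + β * q` only the components of `α` and `β` of degree `N - k <
  -- N` occur, so induction on the degree applies.
  have hhom : ∀ N, ∀ r : MvPolynomial σ K, r.IsHomogeneous N → r ∈ T := by
    intro N
    induction N using Nat.strong_induction_on with
    | _ N ih =>
      intro r hr
      obtain ⟨κ, hκ, α, β, h⟩ := hB r
      have h1 := congrArg (homogeneousComponent N) h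
      rw [homogeneousComponent_eq_self hr, map_add, map_add,
        homogeneousComponent_mul_of_isHomogeneous hp,
        homogeneousComponent_mul_of_isHomogeneous hq, Finsupp.sum, map_sum] at h1
      have hrec (α : MvPolynomial σ K) (s : MvPolynomial (Fin 2) K) :
          (if k ≤ N then homogeneousComponent (N - k) α * aeval ![p, q] s else 0) ∈ T := by
        split_ifs with hkN
        · exact hmul _ _ (ih (N - k) (by omega) _ (homogeneousComponent_isHomogeneous _ _))
        · exact T.zero_mem
      rw [h1]
      refine T.add_mem (T.add_mem (T.sum_mem fun m hm ↦ ?_) ?_) ?_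
      · rw [homogeneousComponent_of_mem (isHomogeneous_monomial _ rfl)]
        split_ifs
        · exact hmono m (hκ hm) _
        · exact T.zero_mem
      · simpa using hrec α (X 0)
      · simpa using hrec β (X 1)
  refine (hT r).1 ?_
  rw [← sum_homogeneousComponent r]
  exact T.sum_mem fun N _ ↦ hhom N _ (homogeneousComponent_isHomogeneous _ _)

end Graded

/-! ### Freeness of the polynomial ring over `K[p, q]`. -/

section Free

variable {K : Type*} [Field K] {σ : Type*}

/-- A polynomial ring is free over `K[p, q]` for a regular sequence of two forms `p, q` of one
positive degree. -/
theorem exists_basis_over_aeval {p q : MvPolynomial σ K} {k : ℕ} (hk : 0 < k)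
    (hp : p.IsHomogeneous k) (hq : q.IsHomogeneous k) (hp0 : p ≠ 0)
    (hreg : ∀ x, p ∣ q * x → p ∣ x) :
    ∃ B : Set (σ →₀ ℕ),
      (∀ r, ∃ c : (σ →₀ ℕ) →₀ MvPolynomial (Fin 2) K, ↑c.support ⊆ B ∧
        r = c.sum fun m s ↦ aeval ![p, q] s * monomial m 1) ∧
      ∀ (F : Finset (σ →₀ ℕ)) (c : (σ →₀ ℕ) → MvPolynomial (Fin 2) K), ↑F ⊆ B →
        ∑ m ∈ F, aeval ![p, q] (c m) * monomial m 1 = 0 → ∀ m ∈ F, c m = 0 := by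
  let I : Ideal (MvPolynomial σ K) := Ideal.span {p, q}
  let v : (σ →₀ ℕ) → MvPolynomial σ K ⧸ I := fun m ↦ Ideal.Quotient.mkₐ K I (monomial m 1)
  -- A maximal set of monomials with independent classes is a `K`-basis of the quotient by `(p, q)`.
  obtain ⟨B, -, -, hspan, hli⟩ :=
    exists_linearIndepOn_extension (K := K) (v := v) (linearIndepOn_empty K v)
      (Set.empty_subset Set.univ)
  refine ⟨B, exists_sum_aeval_mul_eq hk hp hq B fun r ↦ ?_, fun F c hF hc ↦ ?_⟩
  · have hr : Ideal.Quotient.mkₐ K I r ∈ Submodule.span K (v '' B) := by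
      rw [r.as_sum, map_sum]
      refine Submodule.sum_mem _ fun m _ ↦ ?_
      have : monomial m (coeff m r) = coeff m r • monomial m (1 : K) := by simp [smul_monomial]
      rw [this, map_smul]
      exact Submodule.smul_mem _ _ (hspan ⟨m, trivial, rfl⟩)
    obtain ⟨κ, hκ, h⟩ := (Finsupp.mem_span_image_iff_linearCombination K).1 hr
    refine ⟨κ, hκ, ?_⟩
    have h1 : Ideal.Quotient.mkₐ K I (κ.sum fun m c ↦ monomial m c) =
        Ideal.Quotient.mkₐ K I r := by
      rw [← h, Finsupp.linearCombination_apply, Finsupp.sum, Finsupp.sum, map_sum]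
      refine Finset.sum_congr rfl fun m _ ↦ ?_
      rw [← map_smul]
      simp [smul_monomial]
    have h2 : r - κ.sum (fun m c ↦ monomial m c) ∈ I := Ideal.Quotient.eq.1 h1.symm
    obtain ⟨α, β, h3⟩ := Ideal.mem_span_pair.1 h2
    exact ⟨α, β, by linear_combination -h3⟩
  · refine eq_zero_of_sum_aeval_mul_eq_zero (fun x hx ↦ ?_) hreg (fun m ↦ monomial m (1 : K)) F
      (fun κ hκ ↦ ?_) c hc
    · exact (mul_eq_zero.1 hx).resolve_left hp0
    · refine linearIndepOn_finset_iff.1 (hli.mono hF) κ ?_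
      have := Ideal.Quotient.eq_zero_iff_mem.2 hκ
      rw [← this]
      simp only [v, ← map_smul, ← map_sum]
      rfl

end Free

end RationalCurve

namespace RationalCurve

/-! ### Elements of a field generated by ratios. -/

section Adjoin

variable {K L ι : Type*} [Field K] [Field L] [Algebra K L]

/-- The elements of the field generated by the quotients `w i / w i₀` are quotients of forms of
one degree in `w`. -/
theorem exists_forms_of_mem_adjoin (w : ι → L) {i₀ : ι} (h₀ : w i₀ ≠ 0) {x : L}
    (hx : x ∈ IntermediateField.adjoin K (Set.range fun i ↦ w i / w i₀)) :
    ∃ (e : ℕ) (P Q : MvPolynomial ι K), P.IsHomogeneous e ∧ Q.IsHomogeneous e ∧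
      aeval w Q ≠ 0 ∧ x * aeval w Q = aeval w P := by
  induction hx using IntermediateField.adjoin_induction with
  | mem x hx =>
    obtain ⟨i, rfl⟩ := hx
    refine ⟨1, X i, X i₀, isHomogeneous_X _ _, isHomogeneous_X _ _, by simpa using h₀, ?_⟩
    simp [div_mul_cancel₀ _ h₀]
  | algebraMap x =>
    exact ⟨0, C x, 1, isHomogeneous_C _ _, isHomogeneous_one _ _, by simp, by simp⟩
  | add x y _ _ hx hy =>
    obtain ⟨e, P, Q, hP, hQ, h0, h⟩ := hx
    obtain ⟨e', P', Q', hP', hQ', h0', h'⟩ := hy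
    refine ⟨e + e', P * Q' + Q * P', Q * Q', (hP.mul hQ').add (hQ.mul hP'), hQ.mul hQ', ?_, ?_⟩
    · rw [map_mul]
      exact mul_ne_zero h0 h0'
    · rw [map_mul, map_add, map_mul, map_mul, ← h, ← h']
      ring
  | inv x _ hx =>
    obtain ⟨e, P, Q, hP, hQ, h0, h⟩ := hx
    rcases eq_or_ne x 0 with rfl | hx0
    · exact ⟨0, 0, 1, isHomogeneous_zero _ _ _, isHomogeneous_one _ _, by simp, by simp⟩
    · refine ⟨e, Q, P, hQ, hP, h ▸ mul_ne_zero hx0 h0, ?_⟩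
      rw [← h, inv_mul_cancel_left₀ hx0]
  | mul x y _ _ hx hy =>
    obtain ⟨e, P, Q, hP, hQ, h0, h⟩ := hx
    obtain ⟨e', P', Q', hP', hQ', h0', h'⟩ := hy
    refine ⟨e + e', P * P', Q * Q', hP.mul hP', hQ.mul hQ', ?_, ?_⟩
    · rw [map_mul]
      exact mul_ne_zero h0 h0'
    · rw [map_mul, map_mul, ← h, ← h']
      ring

end Adjoin

/-! ### Degrees of syzygies of a tuple from `K[p, q]`. -/

section Syzygies

variable {K : Type*} [Field K]

theorem homogeneousComponent_aeval_eq_zero {σ : Type*} {p q : MvPolynomial σ K} {k : ℕ}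
    (hp : p.IsHomogeneous k) (hq : q.IsHomogeneous k) (s : MvPolynomial (Fin 2) K) {N : ℕ}
    (hN : ¬ k ∣ N) : homogeneousComponent N (aeval ![p, q] s) = 0 := by
  rw [← sum_homogeneousComponent s, map_sum, map_sum]
  refine Finset.sum_eq_zero fun m _ ↦ ?_
  have h : (aeval ![p, q] (homogeneousComponent m s)).IsHomogeneous (k * m) :=
    (homogeneousComponent_isHomogeneous m s).aeval _ (by
      intro i
      fin_cases i
      · exact hp
      · exact hq)
  rw [homogeneousComponent_of_mem h, if_neg]
  rintro rfl
  exact hN (dvd_mul_right _ _)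

/-- If the syzygies of `a` are those of a tuple of elements of `K[p, q]`, where `p, q` is a regular
sequence of forms of degree `k`, then the degrees of a graded basis of the module of syzygies are
divisible by `k`. -/
theorem dvd_degree_of_syzygies_eq {d : ℕ} {a : Fin (d + 1) → MvPolynomial (Fin 2) K}
    {μ : Fin d → ℕ} {A : Fin d → Fin (d + 1) → MvPolynomial (Fin 2) K}
    (hA : ∀ i j, (A i j).IsHomogeneous (μ i))
    (hinj : Function.Injective (Fintype.linearCombination (MvPolynomial (Fin 2) K) A))
    (hex : Function.Exact (Fintype.linearCombination (MvPolynomial (Fin 2) K) A)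
      (Fintype.linearCombination (MvPolynomial (Fin 2) K) a))
    {p q : MvPolynomial (Fin 2) K} {k : ℕ} (hk : 0 < k)
    (hp : p.IsHomogeneous k) (hq : q.IsHomogeneous k) (hp0 : p ≠ 0)
    (hreg : ∀ x, p ∣ q * x → p ∣ x) (b : Fin (d + 1) → MvPolynomial (Fin 2) K)
    (hb : ∀ c : Fin (d + 1) → MvPolynomial (Fin 2) K,
      ∑ j, c j * a j = 0 ↔ ∑ j, c j * aeval ![p, q] (b j) = 0) (i : Fin d) : k ∣ μ i := by
  classical
  by_contra hki
  obtain ⟨B, hspan, hli⟩ := exists_basis_over_aeval hk hp hq hp0 hreg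
  choose Γ hΓB hΓ using fun j ↦ hspan (A i j)
  let F : Finset (Fin 2 →₀ ℕ) := Finset.univ.biUnion fun j ↦ (Γ j).support
  have hF : (F : Set (Fin 2 →₀ ℕ)) ⊆ B := by
    intro m hm
    obtain ⟨j, -, hj⟩ := Finset.mem_biUnion.1 hm
    exact hΓB j hj
  have hAF j : A i j = ∑ m ∈ F, aeval ![p, q] (Γ j m) * monomial m 1 := by
    rw [hΓ j]
    exact Finsupp.sum_of_support_subset _
      (Finset.subset_biUnion_of_mem (fun j ↦ (Γ j).support) (Finset.mem_univ j)) _ (by simp)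
  have hAi : ∑ j, A i j * a j = 0 := by
    have := (hex (A i)).2 ⟨Pi.single i 1, by simp⟩
    simpa [Fintype.linearCombination_apply] using this
  -- Expanded in the monomial basis, the syzygy `A i` falls apart into one syzygy of `b` over `K[p,
  -- q]` for each `m`.
  have h1 : ∑ m ∈ F, aeval ![p, q] (∑ j, Γ j m * b j) * monomial m 1 = 0 := by
    rw [← (hb _).1 hAi]
    simp_rw [hAF, map_sum, map_mul, Finset.sum_mul]
    rw [Finset.sum_comm]
    refine Finset.sum_congr rfl fun j _ ↦ Finset.sum_congr rfl fun m _ ↦ ?_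
    ring
  have h2 := hli F _ hF h1
  -- Each piece is again a syzygy of `a`, hence a combination of the rows of `A`.
  have h3 m : ∃ g : Fin d → MvPolynomial (Fin 2) K, m ∈ F →
      ∀ j, aeval ![p, q] (Γ j m) = ∑ l, g l * A l j := by
    by_cases hm : m ∈ F
    · have h4 : ∑ j, aeval ![p, q] (Γ j m) * aeval ![p, q] (b j) = 0 := by
        simpa using congrArg (aeval ![p, q]) (h2 m hm)
      have h5 := (hb _).2 h4
      obtain ⟨g, hg⟩ := (hex fun j ↦ aeval ![p, q] (Γ j m)).1
        (by simpa [Fintype.linearCombination_apply] using h5)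
      refine ⟨g, fun _ j ↦ ?_⟩
      simpa [Fintype.linearCombination_apply] using (congrFun hg j).symm
    · exact ⟨0, fun h ↦ absurd h hm⟩
  choose g hg using h3
  have h4 : (fun l ↦ ∑ m ∈ F, monomial m 1 * g m l) = Pi.single i 1 := by
    apply hinj
    ext1 j
    simp only [Fintype.linearCombination_apply, Finset.sum_apply, Pi.smul_apply, smul_eq_mul]
    trans A i j
    · rw [hAF j]
      simp_rw [Finset.sum_mul]
      rw [Finset.sum_comm]
      refine Finset.sum_congr rfl fun m hm ↦ ?_
      rw [hg m hm j, Finset.sum_mul]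
      refine Finset.sum_congr rfl fun l _ ↦ ?_
      ring
    · simp [Pi.single_apply]
  -- In `h4` the `i`-th entry has constant term 1, so some `g m i` has a nonzero constant term.
  have h5 : ∃ m ∈ F, coeff 0 (g m i) ≠ 0 := by
    by_contra! h
    have := congrArg constantCoeff (congrFun h4 i)
    rw [map_sum, Pi.single_eq_same, map_one] at this
    refine one_ne_zero (this.symm.trans (Finset.sum_eq_zero fun m hm ↦ ?_))
    rw [map_mul, constantCoeff_eq, h m hm, mul_zero]
  obtain ⟨m, hm, hmi⟩ := h5
  -- The piece at `m` has entries in `K[p, q]`, so its component of degree `μ i` vanishes. By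
  -- injectivity so do the matching components of the coefficients; at `l = i` this is the constant
  -- term of `g m i`.
  have h6 : (fun l ↦ if μ l ≤ μ i then homogeneousComponent (μ i - μ l) (g m l) else 0) = 0 := by
    apply hinj
    ext1 j
    simp only [Fintype.linearCombination_apply, Finset.sum_apply, Pi.smul_apply, smul_eq_mul,
      Pi.zero_apply, zero_mul, Finset.sum_const_zero]
    refine Eq.trans ?_ (homogeneousComponent_aeval_eq_zero hp hq (Γ j m) hki)
    rw [hg m hm j, map_sum]
    refine Finset.sum_congr rfl fun l _ ↦ ?_
    rw [homogeneousComponent_mul_of_isHomogeneous (hA l j)]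
    split_ifs <;> simp
  have h7 := congrFun h6 i
  simp only [le_refl, if_true, tsub_self, homogeneousComponent_zero, Pi.zero_apply] at h7
  exact hmi (C_eq_zero.1 h7)

end Syzygies

/-! ### Passing between binary forms and univariate polynomials. -/

section Homogenize

variable {K : Type*} [Field K]

/-- Homogenizing the Bézout identity puts a power of `X 1` in the ideal of the two forms, so a
common divisor is a power of `X 1` up to a unit. It is not divisible by `X 1`: the polynomial of
larger degree contributes a nonzero coefficient at `X 0 ^ k`. -/
theorem isRelPrime_homogenize {u v : Polynomial K} (h : IsCoprime u v)
    (hk : 0 < max u.natDegree v.natDegree) :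
    IsRelPrime (u.homogenize (max u.natDegree v.natDegree))
      (v.homogenize (max u.natDegree v.natDegree)) := by
  set k := max u.natDegree v.natDegree with hkdef
  obtain ⟨α, β, hαβ⟩ := h
  intro c hcu hcv
  have hcX : c ∣ (X 1 : MvPolynomial (Fin 2) K) ^ (max α.natDegree β.natDegree + k) := by
    rw [← Polynomial.homogenize_one, ← hαβ, Polynomial.homogenize_add,
      Polynomial.homogenize_mul _ _ (le_max_left _ _) (le_max_left _ _),
      Polynomial.homogenize_mul _ _ (le_max_right _ _) (le_max_right _ _)]
    exact dvd_add (hcu.mul_left _) (hcv.mul_left _)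
  obtain ⟨i, -, hi⟩ := (dvd_prime_pow (X_prime (i := (1 : Fin 2)) (R := K)) _).1 hcX
  rcases i.eq_zero_or_pos with rfl | hi0
  · rw [pow_zero] at hi
    exact associated_one_iff_isUnit.1 hi
  · exfalso
    have hX : (X 1 : MvPolynomial (Fin 2) K) ∣ c :=
      (dvd_pow_self _ hi0.ne').trans hi.symm.dvd
    have key (w : Polynomial K) (hw : c ∣ w.homogenize k) : w.coeff k = 0 := by
      obtain ⟨z, hz⟩ := hX.trans hw
      have := congrArg (coeff (Finsupp.single 0 k)) hz
      rw [Polynomial.coeff_homogenize, coeff_X_mul'] at this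
      simpa using this
    rcases max_choice u.natDegree v.natDegree with hm | hm
    · have := key u hcu
      rw [hkdef, hm, Polynomial.coeff_natDegree, Polynomial.leadingCoeff_eq_zero] at this
      subst this
      rw [hm] at hkdef
      simp at hkdef
      omega
    · have := key v hcv
      rw [hkdef, hm, Polynomial.coeff_natDegree, Polynomial.leadingCoeff_eq_zero] at this
      subst this
      rw [hm] at hkdef
      simp at hkdef
      omega

theorem eq_of_aeval_X_one_eq {f g : MvPolynomial (Fin 2) K} {N : ℕ} (hf : f.IsHomogeneous N)
    (hg : g.IsHomogeneous N)
    (h : aeval ![Polynomial.X, (1 : Polynomial K)] f = aeval ![Polynomial.X, 1] g) : f = g := by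
  rw [← Polynomial.homogenize_eq_of_isHomogeneous hf rfl,
    ← Polynomial.homogenize_eq_of_isHomogeneous hg rfl, h]

theorem aeval_mul_eq_pow_mul {A σ : Type*} [CommRing A] [Algebra K A] {φ : MvPolynomial σ K} {n : ℕ}
    (hφ : φ.IsHomogeneous n) (h : A) (f : σ → A) :
    aeval (fun l ↦ h * f l) φ = h ^ n * aeval f φ := by
  conv_lhs => rw [φ.as_sum]
  conv_rhs => rw [φ.as_sum]
  rw [map_sum, map_sum, Finset.mul_sum]
  refine Finset.sum_congr rfl fun m hm ↦ ?_
  rw [aeval_monomial, aeval_monomial]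
  simp only [Finsupp.prod, mul_pow]
  rw [Finset.prod_mul_distrib, Finset.prod_pow_eq_pow_sum,
    hφ.degree_eq_sum_deg_support hm]
  ring

end Homogenize

/-! ### Constructing the inverse rational map. -/

section Proper

variable {K : Type*} [Field K]

/-- A one-sided inverse suffices: coprimality of `X 0` and `X 1` gives `P(a) = X 0 * f` and `Q(a) =
X 1 * f`. By homogeneity `a j (P(a), Q(a)) = f ^ n * a j`, which is the other composite. -/
theorem isProper_of_forms {n d : ℕ} {a : Fin (d + 1) → MvPolynomial (Fin 2) K}
    (ha : ∀ j, (a j).IsHomogeneous n) {j₀ : Fin (d + 1)} (h₀ : a j₀ ≠ 0) {e : ℕ}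
    {P Q : MvPolynomial (Fin (d + 1)) K} (hP : P.IsHomogeneous e) (hQ : Q.IsHomogeneous e)
    (hQ0 : aeval a Q ≠ 0) (h : X 0 * aeval a Q = X 1 * aeval a P) : IsProper a := by
  have hX : ¬ (X 1 : MvPolynomial (Fin 2) K) ∣ X 0 := by
    intro h
    have := X_dvd_X.1 h
    simp at this
  obtain ⟨f, hf⟩ : (X 1 : MvPolynomial (Fin 2) K) ∣ aeval a Q :=
    (X_prime.dvd_or_dvd (h ▸ dvd_mul_right _ _ : X 1 ∣ X 0 * aeval a Q)).resolve_left hX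
  have hf' : aeval a P = X 0 * f := by
    rw [hf] at h
    refine mul_left_cancel₀ (X_ne_zero (1 : Fin 2)) ?_
    rw [← h]
    ring
  have hf0 : f ≠ 0 := by
    rintro rfl
    exact hQ0 (by rw [hf, mul_zero])
  have key j : aeval a (aeval ![P, Q] (a j)) = f ^ n * a j := by
    have h1 : aeval a (aeval ![P, Q] (a j)) = aeval (fun l ↦ f * X l) (a j) := by
      rw [← AlgHom.comp_apply, comp_aeval]
      congr 2
      ext1 l
      fin_cases l
      · exact hf'.trans (mul_comm _ _)
      · exact hf.trans (mul_comm _ _)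
    rw [h1, aeval_mul_eq_pow_mul (ha j), aeval_X_left_apply]
  refine ⟨e, ![P, Q], ?_, ⟨1, ?_⟩, ?_, ⟨j₀, ?_⟩, ?_⟩
  · intro l
    fin_cases l
    · exact hP
    · exact hQ
  · simpa [curveIdeal, RingHom.mem_ker] using hQ0
  · simpa using h
  · rw [curveIdeal, RingHom.mem_ker]
    change aeval a _ ≠ 0
    rw [key]
    exact mul_ne_zero (pow_ne_zero _ hf0) h₀
  · intro i j
    rw [curveIdeal, RingHom.mem_ker]
    rw [map_sub, map_mul, map_mul, key, key, aeval_X, aeval_X]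
    ring

end Proper

end RationalCurve

namespace RationalCurve

/-! ### Lüroth's theorem and properness when the gcd is 1. -/

section CoprimeType

variable {K : Type*} [Field K]

/-- Setting `t = 1`, as a map into the field of rational functions. -/
noncomputable def dehomogenize (K : Type*) [Field K] : MvPolynomial (Fin 2) K →ₐ[K] RatFunc K :=
  (IsScalarTower.toAlgHom K (Polynomial K) (RatFunc K)).comp (aeval ![Polynomial.X, 1])

theorem dehomogenize_apply (f : MvPolynomial (Fin 2) K) :
    dehomogenize K f = algebraMap (Polynomial K) (RatFunc K) (aeval ![Polynomial.X, 1] f) := rfl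

theorem eq_of_dehomogenize_eq {f g : MvPolynomial (Fin 2) K} {N : ℕ} (hf : f.IsHomogeneous N)
    (hg : g.IsHomogeneous N) (h : dehomogenize K f = dehomogenize K g) : f = g :=
  eq_of_aeval_X_one_eq hf hg (RatFunc.algebraMap_injective K h)

theorem dehomogenize_ne_zero {f : MvPolynomial (Fin 2) K} {N : ℕ} (hf : f.IsHomogeneous N)
    (h : f ≠ 0) : dehomogenize K f ≠ 0 := fun h' ↦
  h (eq_of_dehomogenize_eq hf (isHomogeneous_zero _ _ _) (h'.trans (map_zero _).symm))

theorem dehomogenize_aeval {ι : Type*} (w : ι → MvPolynomial (Fin 2) K) (P : MvPolynomial ι K) :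
    dehomogenize K (aeval w P) = aeval (fun i ↦ dehomogenize K (w i)) P := by
  rw [← AlgHom.comp_apply, comp_aeval]

theorem dehomogenize_homogenize (u : Polynomial K) {k : ℕ} (hk : u.natDegree ≤ k) :
    dehomogenize K (u.homogenize k) = algebraMap (Polynomial K) (RatFunc K) u := by
  rw [dehomogenize_apply, Polynomial.aeval_homogenize_X_one _ hk]

/-- The subfield of `K(s/t)` generated by the quotients of the forms `a j`. -/
noncomputable def quotientField {d : ℕ} (a : Fin (d + 1) → MvPolynomial (Fin 2) K)
    (j₀ : Fin (d + 1)) : IntermediateField K (RatFunc K) :=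
  IntermediateField.adjoin K (Set.range fun j ↦ dehomogenize K (a j) / dehomogenize K (a j₀))

theorem isProper_of_quotientField_eq_top {n d : ℕ} {a : Fin (d + 1) → MvPolynomial (Fin 2) K}
    (ha : ∀ j, (a j).IsHomogeneous n) {j₀ : Fin (d + 1)} (h₀ : a j₀ ≠ 0)
    (h : quotientField a j₀ = ⊤) : IsProper a := by
  have hX : RatFunc.X ∈ quotientField a j₀ := h ▸ IntermediateField.mem_top
  obtain ⟨e, P, Q, hP, hQ, hQ0, hPQ⟩ := 
    exists_forms_of_mem_adjoin (fun j ↦ dehomogenize K (a j)) (dehomogenize_ne_zero (ha j₀) h₀) hX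
  rw [← dehomogenize_aeval] at hQ0
  rw [← dehomogenize_aeval, ← dehomogenize_aeval] at hPQ
  refine isProper_of_forms ha h₀ hP hQ (fun h ↦ hQ0 (by rw [h, map_zero])) ?_
  refine eq_of_dehomogenize_eq ((isHomogeneous_X _ _).mul (hQ.aeval _ ha))
    ((isHomogeneous_X _ _).mul (hP.aeval _ ha)) ?_
  rw [map_mul, map_mul, ← hPQ]
  simp [dehomogenize_apply]

/-- If all ratios were constants, any second form would be a multiple of `a j₀`. This makes the
Lüroth generator nonconstant. -/
theorem quotientField_ne_bot {n d : ℕ} (hd : 1 ≤ d) {a : Fin (d + 1) → MvPolynomial (Fin 2) K}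
    (ha : ∀ j, (a j).IsHomogeneous n) (hli : LinearIndependent K a) (j₀ : Fin (d + 1)) :
    quotientField a j₀ ≠ ⊥ := by
  intro h
  have : Nontrivial (Fin (d + 1)) := Fin.nontrivial_iff_two_le.2 (by omega)
  obtain ⟨j, hj⟩ := exists_ne j₀
  have hmem : dehomogenize K (a j) / dehomogenize K (a j₀) ∈ quotientField a j₀ :=
    IntermediateField.subset_adjoin _ _ ⟨j, rfl⟩
  rw [h, IntermediateField.mem_bot] at hmem
  obtain ⟨c, hc⟩ := hmem
  rw [eq_div_iff (dehomogenize_ne_zero (ha j₀) (hli.ne_zero j₀)), ← Algebra.smul_def,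
    ← map_smul] at hc
  have h1 : c • a j₀ = a j :=
    eq_of_dehomogenize_eq ((homogeneousSubmodule _ K n).smul_mem c (ha j₀)) (ha j) hc
  refine hli.notMem_span_image (s := {j₀}) (x := j) (by simpa using hj) ?_
  rw [Set.image_singleton, Submodule.mem_span_singleton]
  exact ⟨c, h1⟩

theorem dvd_degree_of_quotientField_eq_adjoin {n d : ℕ}
    {a : Fin (d + 1) → MvPolynomial (Fin 2) K} (ha : ∀ j, (a j).IsHomogeneous n)
    {j₀ : Fin (d + 1)} (h₀ : a j₀ ≠ 0) {μ : Fin d → ℕ} (hμ : HasMuType a μ) {f : RatFunc K}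
    (hf : quotientField a j₀ = IntermediateField.adjoin K {f})
    (hk : 0 < max f.num.natDegree f.denom.natDegree) (i : Fin d) :
    max f.num.natDegree f.denom.natDegree ∣ μ i := by
  classical
  obtain ⟨-, -, A, hA, hinj, hex⟩ := hμ
  set k := max f.num.natDegree f.denom.natDegree with hkdef
  have hrel : IsRelPrime (f.num.homogenize k) (f.denom.homogenize k) :=
    isRelPrime_homogenize f.isCoprime_num_denom hk
  have hDp := dehomogenize_homogenize f.num (le_max_left _ _ : _ ≤ k)
  have hDq := dehomogenize_homogenize f.denom (le_max_right _ _ : _ ≤ k)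
  have hp := Polynomial.isHomogeneous_homogenize (n := k) f.num
  have hq := Polynomial.isHomogeneous_homogenize (n := k) f.denom
  set p := f.num.homogenize k with hpdef
  set q := f.denom.homogenize k with hqdef
  have hpq (l : Fin 2) : (![p, q] l).IsHomogeneous k := by
    fin_cases l
    · exact hp
    · exact hq
  have hf0 : f ≠ 0 := by
    intro h
    rw [hkdef, h] at hk
    simp at hk
  have hp0 : p ≠ 0 := fun h ↦ RatFunc.num_ne_zero hf0
    (Polynomial.eq_zero_of_homogenize_eq_zero (le_max_left _ _) h)
  have hDq0 : dehomogenize K (![p, q] 1) ≠ 0 := by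
    change dehomogenize K q ≠ 0
    rw [hDq]
    exact RatFunc.algebraMap_ne_zero f.denom_ne_zero
  have hle : IntermediateField.adjoin K {f} ≤ IntermediateField.adjoin K
      (Set.range fun l : Fin 2 ↦ dehomogenize K (![p, q] l) / dehomogenize K (![p, q] 1)) := by
    rw [IntermediateField.adjoin_simple_le_iff]
    refine IntermediateField.subset_adjoin _ _ ⟨0, ?_⟩
    change dehomogenize K p / dehomogenize K q = f
    rw [hDp, hDq, RatFunc.num_div_denom]
  have hmem (j) : dehomogenize K (a j) / dehomogenize K (a j₀) ∈ IntermediateField.adjoin K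
      (Set.range fun l : Fin 2 ↦ dehomogenize K (![p, q] l) / dehomogenize K (![p, q] 1)) :=
    hle (hf ▸ IntermediateField.subset_adjoin _ _ ⟨j, rfl⟩)
  choose e P Q hP hQ hQ0 hPQ using fun j ↦
    exists_forms_of_mem_adjoin (fun l ↦ dehomogenize K (![p, q] l)) hDq0 (hmem j)
  have hQ0' j : dehomogenize K (aeval ![p, q] (Q j)) ≠ 0 := by
    rw [dehomogenize_aeval]
    exact hQ0 j
  have hPQ' j : dehomogenize K (a j) / dehomogenize K (a j₀) *
      dehomogenize K (aeval ![p, q] (Q j)) = dehomogenize K (aeval ![p, q] (P j)) := by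
    rw [dehomogenize_aeval, dehomogenize_aeval]
    exact hPQ j
  have hD₀ := dehomogenize_ne_zero (ha j₀) h₀
  -- The common denominator `∏ l, Q l` exhibits `a` as proportional to a tuple from `K[p, q]`. Both
  -- sides have degree `n + k * ∑ l, e l`, so the identity can be checked at `t = 1`.
  have key j : a j₀ * aeval ![p, q] (P j * ∏ l ∈ Finset.univ.erase j, Q l) =
      a j * aeval ![p, q] (∏ l, Q l) := by
    have hdeg : ∑ l, e l = e j + ∑ l ∈ Finset.univ.erase j, e l :=
      (Finset.add_sum_erase _ _ (Finset.mem_univ j)).symm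
    refine eq_of_dehomogenize_eq (N := n + k * ∑ l, e l) ?_ ?_ ?_
    · refine (ha j₀).mul (IsHomogeneous.aeval ?_ _ hpq)
      rw [hdeg]
      exact (hP j).mul (IsHomogeneous.prod _ _ _ fun l _ ↦ hQ l)
    · exact (ha j).mul (IsHomogeneous.aeval (IsHomogeneous.prod _ _ _ fun l _ ↦ hQ l) _ hpq)
    · rw [← Finset.mul_prod_erase Finset.univ Q (Finset.mem_univ j)]
      simp only [map_mul]
      rw [← hPQ' j]
      field_simp
  have hρ : aeval ![p, q] (∏ l, Q l) ≠ 0 := by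
    rw [map_prod]
    exact Finset.prod_ne_zero_iff.2 fun l _ h ↦ hQ0' l (by rw [h, map_zero])
  refine dvd_degree_of_syzygies_eq hA hinj hex hk hp hq hp0 (fun x hx ↦ hrel.dvd_of_dvd_mul_left hx)
    (fun j ↦ P j * ∏ l ∈ Finset.univ.erase j, Q l) (fun c ↦ ?_) i
  have hsum : a j₀ * ∑ j, c j * aeval ![p, q] (P j * ∏ l ∈ Finset.univ.erase j, Q l) =
      aeval ![p, q] (∏ l, Q l) * ∑ j, c j * a j := by
    rw [Finset.mul_sum, Finset.mul_sum]
    refine Finset.sum_congr rfl fun j _ ↦ ?_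
    linear_combination c j * key j
  constructor
  · intro h
    rw [h, mul_zero] at hsum
    exact (mul_eq_zero.1 hsum).resolve_left h₀
  · intro h
    rw [h, mul_zero] at hsum
    exact (mul_eq_zero.1 hsum.symm).resolve_left hρ

theorem isProper_of_gcd_eq_one {n d : ℕ} (hd : 1 ≤ d) {μ : Fin d → ℕ}
    {a : Fin (d + 1) → MvPolynomial (Fin 2) K} (ha : a ∈ muStratum K n d μ)
    (hμ : Finset.univ.gcd μ = 1) : IsProper a := by
  obtain ⟨⟨hhom, hli, -⟩, hmu⟩ := ha
  have h₀ : a 0 ≠ 0 := hli.ne_zero 0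
  have hbot := quotientField_ne_bot hd hhom hli 0
  obtain ⟨f, hf, hfC⟩ : ∃ f, quotientField a 0 = IntermediateField.adjoin K {f} ∧
      ¬ ∃ c, f = RatFunc.C c :=
    ⟨_, RatFunc.Luroth.eq_adjoin_generator, RatFunc.Luroth.generator_ne_C hbot⟩
  have hk : 0 < max f.num.natDegree f.denom.natDegree := by
    by_contra hk
    exact hfC ((RatFunc.eq_C_iff _).2 (Nat.max_eq_zero_iff.1 (Nat.eq_zero_of_not_pos hk)))
  have hdvd : max f.num.natDegree f.denom.natDegree ∣ Finset.univ.gcd μ :=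
    Finset.dvd_gcd fun i _ ↦ dvd_degree_of_quotientField_eq_adjoin hhom h₀ hmu hf hk i
  rw [hμ, Nat.dvd_one] at hdvd
  refine isProper_of_quotientField_eq_top hhom h₀ ?_
  -- The degree of `K(X)` over `K(f)` is the larger of the degrees of numerator and denominator, now
  -- equal to 1.
  rw [hf, ← IntermediateField.finrank_eq_one_iff_eq_top, RatFunc.finrank_eq_max_natDegree, hdvd]

end CoprimeType

end RationalCurve

namespace RationalCurve

/-! ### A monomial curve of every type, improper when the gcd exceeds 1. -/

section MonomialCurve

variable {K : Type*} [Field K]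

/-- The exponent of `t` in the `j`-th form of the monomial curve of type `μ`. -/
def partialSum {d : ℕ} (μ : Fin d → ℕ) (j : ℕ) : ℕ := ∑ i : Fin d, if (i : ℕ) < j then μ i else 0

/-- The exponent of `s` in the `j`-th form of the monomial curve of type `μ`. -/
def tailSum {d : ℕ} (μ : Fin d → ℕ) (j : ℕ) : ℕ := ∑ i : Fin d, if (i : ℕ) < j then 0 else μ i

/-- The curve `(s^n, s^(n - μ₁) t^(μ₁), …, t^n)`. -/
noncomputable def monomialCurve (K : Type*) [Field K] {d : ℕ} (μ : Fin d → ℕ) (j : Fin (d + 1)) :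
    MvPolynomial (Fin 2) K := X 0 ^ tailSum μ j * X 1 ^ partialSum μ j

/-- The syzygies between neighbouring forms of the monomial curve. -/
noncomputable def monomialSyzygy (K : Type*) [Field K] {d : ℕ} (μ : Fin d → ℕ) (i : Fin d) :
    Fin (d + 1) → MvPolynomial (Fin 2) K :=
  Pi.single i.castSucc (X 1 ^ μ i) - Pi.single i.succ (X 0 ^ μ i)

theorem tailSum_add_partialSum {d : ℕ} (μ : Fin d → ℕ) (j : ℕ) :
    tailSum μ j + partialSum μ j = ∑ i, μ i := by
  rw [tailSum, partialSum, ← Finset.sum_add_distrib]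
  exact Finset.sum_congr rfl fun i _ ↦ by split_ifs <;> simp

theorem partialSum_zero {d : ℕ} (μ : Fin d → ℕ) : partialSum μ 0 = 0 := by simp [partialSum]

theorem tailSum_zero {d : ℕ} (μ : Fin d → ℕ) : tailSum μ 0 = ∑ i, μ i := by simp [tailSum]

theorem tailSum_last {d : ℕ} (μ : Fin d → ℕ) : tailSum μ d = 0 := by simp [tailSum]

theorem partialSum_last {d : ℕ} (μ : Fin d → ℕ) : partialSum μ d = ∑ i, μ i := by
  simp [partialSum]

theorem partialSum_succ {d : ℕ} (μ : Fin d → ℕ) (i : Fin d) :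
    partialSum μ (i + 1) = partialSum μ i + μ i := by
  have h : μ i = ∑ l, if l = i then μ l else 0 := by simp
  rw [partialSum, partialSum, h, ← Finset.sum_add_distrib]
  refine Finset.sum_congr rfl fun l _ ↦ ?_
  rcases lt_trichotomy (l : ℕ) i with h | h | h
  · rw [if_pos (by omega), if_pos h, if_neg (by rintro rfl; omega), add_zero]
  · obtain rfl := Fin.ext h
    simp
  · rw [if_neg (by omega), if_neg (by omega), if_neg (by rintro rfl; omega)]

theorem tailSum_succ {d : ℕ} (μ : Fin d → ℕ) (i : Fin d) :
    tailSum μ i = tailSum μ (i + 1) + μ i := by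
  have h1 := tailSum_add_partialSum μ i
  have h2 := tailSum_add_partialSum μ (i + 1)
  have h3 := partialSum_succ μ i
  omega

theorem partialSum_tail {d : ℕ} (μ : Fin (d + 1) → ℕ) (j : ℕ) :
    partialSum μ (j + 1) = μ 0 + partialSum (Fin.tail μ) j := by
  simp [partialSum, Fin.sum_univ_succ, Fin.tail]

theorem tailSum_tail {d : ℕ} (μ : Fin (d + 1) → ℕ) (j : ℕ) :
    tailSum μ (j + 1) = tailSum (Fin.tail μ) j := by
  simp [tailSum, Fin.sum_univ_succ, Fin.tail]

theorem partialSum_strictMono {d : ℕ} {μ : Fin d → ℕ} (hμ : ∀ i, 1 ≤ μ i) :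
    StrictMono fun j : Fin (d + 1) ↦ partialSum μ j := by
  rw [Fin.strictMono_iff_lt_succ]
  intro i
  have := partialSum_succ μ i
  have := hμ i
  simp only [Fin.val_castSucc, Fin.val_succ]
  omega

theorem monomialCurve_zero {d : ℕ} (μ : Fin d → ℕ) :
    monomialCurve K μ 0 = X 0 ^ ∑ i, μ i := by
  simp [monomialCurve, tailSum_zero, partialSum_zero]

theorem monomialCurve_last {d : ℕ} (μ : Fin d → ℕ) :
    monomialCurve K μ (Fin.last d) = X 1 ^ ∑ i, μ i := by
  simp [monomialCurve, tailSum_last, partialSum_last]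

theorem monomialCurve_succ {d : ℕ} (μ : Fin (d + 1) → ℕ) (j : Fin (d + 1)) :
    monomialCurve K μ j.succ = X 1 ^ μ 0 * monomialCurve K (Fin.tail μ) j := by
  simp only [monomialCurve, Fin.val_succ, tailSum_tail, partialSum_tail, pow_add]
  ring

theorem isRelPrime_X_pow (m n : ℕ) :
    IsRelPrime ((X 0 : MvPolynomial (Fin 2) K) ^ m) (X 1 ^ n) := by
  refine IsRelPrime.pow ?_
  rw [(X_prime (i := (0 : Fin 2)) (R := K)).irreducible.isRelPrime_iff_not_dvd, X_dvd_X]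
  simp

/-- Since all `μ i` are positive, the exponents of `t` increase strictly and the monomials are
distinct. The outer two are pure powers of `s` and `t`, hence coprime. -/
theorem monomialCurve_mem_paramSpace {d : ℕ} {μ : Fin d → ℕ} (hμ : ∀ i, 1 ≤ μ i) :
    monomialCurve K μ ∈ paramSpace K (∑ i, μ i) d := by
  refine ⟨fun j ↦ ?_, ?_, fun h hh ↦ ?_⟩
  · rw [← tailSum_add_partialSum μ j]
    exact (isHomogeneous_X_pow _ _).mul (isHomogeneous_X_pow _ _)
  · have hinj : Function.Injective fun j : Fin (d + 1) ↦
        Finsupp.single (0 : Fin 2) (tailSum μ j) + Finsupp.single 1 (partialSum μ j) := by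
      intro i j h
      have := DFunLike.congr_fun h 1
      simp at this
      exact (partialSum_strictMono hμ).injective this
    have := (basisMonomials (Fin 2) K).linearIndependent.comp _ hinj
    have heq : monomialCurve K μ = basisMonomials (Fin 2) K ∘ fun j : Fin (d + 1) ↦
        Finsupp.single (0 : Fin 2) (tailSum μ j) + Finsupp.single 1 (partialSum μ j) := by
      ext1 j
      simp [monomialCurve, X_pow_eq_monomial, monomial_mul]
    exact heq ▸ this
  · refine isRelPrime_X_pow (K := K) (∑ i, μ i) (∑ i, μ i) ?_ ?_
    · exact monomialCurve_zero (K := K) μ ▸ hh 0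
    · exact monomialCurve_last (K := K) μ ▸ hh (Fin.last d)

theorem monomialSyzygy_zero_zero {d : ℕ} (μ : Fin (d + 1) → ℕ) :
    monomialSyzygy K μ 0 0 = X 1 ^ μ 0 := by
  simp [monomialSyzygy]

theorem monomialSyzygy_zero_succ {d : ℕ} (μ : Fin (d + 1) → ℕ) (j : Fin (d + 1)) :
    monomialSyzygy K μ 0 j.succ = -(Pi.single 0 (X 0 ^ μ 0) : Fin (d + 1) → _) j := by
  simp only [monomialSyzygy, Pi.sub_apply, Pi.single_apply, Fin.succ_inj, Fin.castSucc_zero,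
    Fin.succ_ne_zero, if_false, zero_sub]

theorem monomialSyzygy_succ_zero {d : ℕ} (μ : Fin (d + 1) → ℕ) (i : Fin d) :
    monomialSyzygy K μ i.succ 0 = 0 := by
  simp [monomialSyzygy, Fin.ext_iff]

theorem monomialSyzygy_succ_succ {d : ℕ} (μ : Fin (d + 1) → ℕ) (i : Fin d) (j : Fin (d + 1)) :
    monomialSyzygy K μ i.succ j.succ = monomialSyzygy K (Fin.tail μ) i j := by
  simp [monomialSyzygy, Pi.single_apply, Fin.tail, Fin.ext_iff]

theorem sum_monomialSyzygy_mul {d : ℕ} (μ : Fin d → ℕ) (i : Fin d) :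
    ∑ j, monomialSyzygy K μ i j * monomialCurve K μ j = 0 := by
  simp only [monomialSyzygy, Pi.sub_apply, sub_mul, Finset.sum_sub_distrib, Pi.single_apply,
    ite_mul, zero_mul, Finset.sum_ite_eq', Finset.mem_univ, if_true, monomialCurve,
    Fin.val_castSucc, Fin.val_succ]
  rw [partialSum_succ, tailSum_succ μ i, pow_add, pow_add]
  ring

/-- All forms but the first are divisible by `X 1 ^ μ 0`, hence so is `c 0`. Subtracting a multiple
of the first syzygy removes `c 0`, and cancelling `X 1 ^ μ 0` from the other forms leaves the curve
of `Fin.tail μ`. -/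
theorem exists_of_sum_mul_monomialCurve_eq_zero {d : ℕ} (μ : Fin d → ℕ)
    (c : Fin (d + 1) → MvPolynomial (Fin 2) K) (hc : ∑ j, c j * monomialCurve K μ j = 0) :
    ∃ w : Fin d → MvPolynomial (Fin 2) K, ∀ j, c j = ∑ i, w i * monomialSyzygy K μ i j := by
  induction d with
  | zero =>
    refine ⟨0, fun j ↦ ?_⟩
    obtain rfl : j = 0 := Fin.ext (by omega)
    simpa [monomialCurve_zero] using hc
  | succ d ih =>
    rw [Fin.sum_univ_succ, monomialCurve_zero] at hc
    simp_rw [monomialCurve_succ] at hc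
    have h1 : c 0 * X 0 ^ (∑ i, μ i) +
        X 1 ^ μ 0 * ∑ j : Fin (d + 1), c j.succ * monomialCurve K (Fin.tail μ) j = 0 := by
      rw [← hc, Finset.mul_sum]
      congr 1
      exact Finset.sum_congr rfl fun j _ ↦ by ring
    obtain ⟨w₀, hw₀⟩ : X 1 ^ μ 0 ∣ c 0 := by
      have : (X 1 : MvPolynomial (Fin 2) K) ^ μ 0 ∣ c 0 * X 0 ^ (∑ i, μ i) :=
        ⟨-∑ j : Fin (d + 1), c j.succ * monomialCurve K (Fin.tail μ) j,
          by linear_combination h1⟩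
      exact (isRelPrime_X_pow _ _).symm.dvd_of_dvd_mul_right this
    have h2 : w₀ * X 0 ^ (∑ i, μ i) +
        ∑ j : Fin (d + 1), c j.succ * monomialCurve K (Fin.tail μ) j = 0 := by
      refine (mul_eq_zero.1 ?_).resolve_left (pow_ne_zero (μ 0) (X_ne_zero (R := K) (1 : Fin 2)))
      rw [← h1, hw₀]
      ring
    obtain ⟨w, hw⟩ := ih (Fin.tail μ)
      (fun j ↦ c j.succ + w₀ * (Pi.single 0 (X 0 ^ μ 0) : Fin (d + 1) → _) j) (by
        rw [← h2]
        simp only [add_mul, Finset.sum_add_distrib, Pi.single_apply, mul_ite, ite_mul, mul_zero,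
          zero_mul, Finset.sum_ite_eq', Finset.mem_univ, if_true, monomialCurve_zero]
        rw [Fin.sum_univ_succ μ, pow_add]
        simp only [Fin.tail]
        ring)
    refine ⟨Fin.cons w₀ w, fun j ↦ ?_⟩
    rw [Fin.sum_univ_succ]
    simp only [Fin.cons_zero, Fin.cons_succ]
    refine Fin.cases ?_ (fun j ↦ ?_) j
    · simp only [monomialSyzygy_zero_zero, monomialSyzygy_succ_zero, mul_zero,
        Finset.sum_const_zero, add_zero]
      rw [hw₀, mul_comm]
    · simp only [monomialSyzygy_zero_succ, monomialSyzygy_succ_succ]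
      linear_combination hw j

/-- The syzygy matrix is triangular: only the first syzygy has a nonzero entry at index 0. -/
theorem eq_zero_of_sum_mul_monomialSyzygy_eq_zero {d : ℕ} (μ : Fin d → ℕ)
    (w : Fin d → MvPolynomial (Fin 2) K) (hw : ∀ j, ∑ i, w i * monomialSyzygy K μ i j = 0) :
    w = 0 := by
  induction d with
  | zero => exact Subsingleton.elim _ _
  | succ d ih =>
    have h0 : w 0 = 0 := by
      have := hw 0
      rw [Fin.sum_univ_succ] at this
      simpa [monomialSyzygy_zero_zero, monomialSyzygy_succ_zero] using this
    have h1 := ih (Fin.tail μ) (Fin.tail w) fun j ↦ by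
      have := hw j.succ
      rw [Fin.sum_univ_succ, h0, zero_mul, zero_add] at this
      simpa only [monomialSyzygy_succ_succ, Fin.tail] using this
    ext1 i
    refine Fin.cases h0 (fun i ↦ ?_) i
    exact congrFun h1 i

theorem monomialCurve_mem_muStratum {d : ℕ} {μ : Fin d → ℕ} (hmono : Monotone μ)
    (hμ : ∀ i, 1 ≤ μ i) : monomialCurve K μ ∈ muStratum K (∑ i, μ i) d μ := by
  refine ⟨monomialCurve_mem_paramSpace hμ, hmono, hμ, monomialSyzygy K μ, fun i j ↦ ?_, ?_, ?_⟩
  · simp only [monomialSyzygy, Pi.sub_apply, Pi.single_apply]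
    refine IsHomogeneous.sub ?_ ?_ <;> split_ifs
    exacts [isHomogeneous_X_pow _ _, isHomogeneous_zero _ _ _, isHomogeneous_X_pow _ _,
      isHomogeneous_zero _ _ _]
  · rw [injective_iff_map_eq_zero]
    intro w hw
    refine eq_zero_of_sum_mul_monomialSyzygy_eq_zero μ w fun j ↦ ?_
    simpa [Fintype.linearCombination_apply] using congrFun hw j
  · intro c
    constructor
    · intro hc
      obtain ⟨w, hw⟩ := exists_of_sum_mul_monomialCurve_eq_zero μ c
        (by simpa [Fintype.linearCombination_apply] using hc)
      refine ⟨w, ?_⟩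
      ext1 j
      simp [Fintype.linearCombination_apply, hw j]
    · rintro ⟨w, rfl⟩
      simp only [Fintype.linearCombination_apply, Finset.sum_apply, Pi.smul_apply, smul_eq_mul,
        Finset.sum_mul]
      rw [Finset.sum_comm]
      refine Finset.sum_eq_zero fun i _ ↦ ?_
      simp_rw [mul_assoc, ← Finset.mul_sum, sum_monomialSyzygy_mul, mul_zero]

/-- Exponents of `X 0` are 1 modulo `g` on the left and 0 modulo `g` on the right. -/
theorem eq_zero_of_X_mul_expand_eq {g : ℕ} (hg : 2 ≤ g) {f h : MvPolynomial (Fin 2) K}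
    (hfh : X 0 * expand g f = X 1 * expand g h) : expand g f = 0 := by
  have key (f : MvPolynomial (Fin 2) K) (m : Fin 2 →₀ ℕ) (hm : coeff m (expand g f) ≠ 0) :
      g ∣ m 0 := by
    by_contra h
    exact hm (coeff_expand_of_not_dvd f h)
  ext m
  rw [coeff_zero]
  by_contra hm
  have h1 := congrArg (coeff (Finsupp.single 0 1 + m)) hfh
  rw [coeff_X_mul, coeff_X_mul'] at h1
  rw [h1] at hm
  split_ifs at hm with h2
  · have h3 := key _ _ hm
    rw [if_pos h2] at h1
    have h4 := key _ _ (h1 ▸ hm)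
    simp only [Finsupp.coe_tsub, Finsupp.coe_add, Pi.sub_apply, Pi.add_apply,
      Finsupp.single_eq_same, Finsupp.single_apply] at h3
    norm_num at h3
    have := (Nat.dvd_add_left h4).1 h3
    have := Nat.le_of_dvd one_pos this
    omega
  · exact hm rfl

/-- Dividing `μ` by `g` shows that every polynomial in the forms lies in `K[s^g, t^g]`. The
condition that `G` inverts the parametrization then forces both `G l` to vanish on the curve. -/
theorem not_isProper_monomialCurve {d : ℕ} {μ : Fin d → ℕ} {g : ℕ} (hg : 2 ≤ g)
    (hdvd : ∀ i, g ∣ μ i) : ¬ IsProper (monomialCurve K μ) := by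
  choose ν hν using hdvd
  have hcurve : monomialCurve K μ = fun j ↦ expand g (monomialCurve K ν j) := by
    have h1 j : partialSum μ j = g * partialSum ν j := by
      simp [partialSum, hν, Finset.mul_sum]
    have h2 j : tailSum μ j = g * tailSum ν j := by
      simp [tailSum, hν, Finset.mul_sum]
    ext1 j
    simp [monomialCurve, h1, h2, pow_mul]
  have hexp (P : MvPolynomial (Fin (d + 1)) K) :
      aeval (monomialCurve K μ) P = expand g (aeval (monomialCurve K ν) P) := by
    rw [hcurve, ← AlgHom.comp_apply, comp_aeval]
  rintro ⟨e, G, -, ⟨l, hl⟩, hG, -⟩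
  rw [curveIdeal, RingHom.mem_ker] at hl
  rw [hexp, hexp] at hG
  have h1 := eq_zero_of_X_mul_expand_eq hg hG
  rw [h1, mul_zero] at hG
  have h0 := (mul_eq_zero.1 hG.symm).resolve_left (X_ne_zero _)
  refine hl ?_
  change aeval (monomialCurve K μ) (G l) = 0
  rw [hexp]
  fin_cases l
  · exact h0
  · exact h1

end MonomialCurve

end RationalCurve

theorem corollary4p3 (K : Type*) [Field K] [Infinite K] (n d : ℕ) (hd : 2 ≤ d)
    (μ : Fin d → ℕ) (hmono : Monotone μ) (hpos : ∀ i, 1 ≤ μ i) (hsum : ∑ i, μ i = n) :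
    (∀ a ∈ RationalCurve.muStratum K n d μ, RationalCurve.IsProper a) ↔
      Finset.univ.gcd μ = 1 := by
  constructor
  · intro h
    by_contra hg
    have hdvd (i : Fin d) : Finset.univ.gcd μ ∣ μ i := Finset.gcd_dvd (Finset.mem_univ i)
    have hg0 : Finset.univ.gcd μ ≠ 0 := fun h0 ↦ by
      have h1 := hdvd ⟨0, by omega⟩
      have h2 := hpos ⟨0, by omega⟩
      rw [h0, zero_dvd_iff] at h1
      omega
    refine RationalCurve.not_isProper_monomialCurve (K := K) (by omega) hdvd (h _ ?_)
    exact hsum ▸ RationalCurve.monomialCurve_mem_muStratum hmono hpos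
  · intro hg a ha
    exact RationalCurve.isProper_of_gcd_eq_one (by omega) ha hg
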